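/- **Route authenticity of SCION path construction.** *Model.* A network consists of nodes (autonomous domains, ADs). Each node either runs a SANDLog program or is an attacker whose behaviour is unconstrained. A node running a program has a table of tuples with reference counts and a list of pending updates (insertions $+p$ and deletions $-p$). It starts with an empty table and an empty list; its first step inserts its base tuples. Afterwards each step processes the first pending update: all rules of which some body tuple is the updated one, whose other body tuples are in the table, and whose constraints and signature checks hold may fire (incremental pipelined semi-naive evaluation; an insertion of a tuple already present, or a deletion of a tuple with further derivations, fires nothing; which substitutions are selected for tuples with the same key is left to the implementation). Generated updates located at the node itself are appended to its pending list, the others go to the network queue. The network delivers queued updates to the node given by their location specifier; a node running a program only accepts tuples of the relations which the program receives from the network. A trace is a finite sequence of such transitions, from a configuration in which no node has started, with non-decreasing time stamps in $\mathbb N$. $p(\vec x)@(n,t)$ means that node $n$ has derived $p(\vec x)$ at some time $\le t$. *Program.* Node $i$ runs $\mathit{prog}(i)$, whose base tuples (arbitrary, depending on the deployment) are $\mathrm{coreTD}(i,c,td,\mathit{ctf})$ ("$c$ is a core of trust domain $td$"), $\mathrm{provider}(i,m,ig)$, $\mathrm{customer}(i,m,eg)$ (neighbour $m$ through interface $ig$,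 resp. $eg$), $\mathrm{publicKeys}(i,m,k)$ and $\mathrm{privateKeys}(i,k)$. Paths are recorded in interface fields $c::ceg::n_1::nig_1::neg_1::n_2::\cdots$ (core, its egress interface, next AD, its ingress and egress interface, next AD, …). The rules say the following. - (b1–b5) A core $c$ of $td$ signs the global information $(c,td,\mathit{time})$ of a beacon, giving $sg$; for a customer $n$ on interface $ceg$ it computes a MAC on $ceg$, signs the beacon contents (interface field $itf=c::ceg::n::\mathrm{nil}$, time stamps $tl=[\mathit{time}]$, hop-field list $ol$ with one entry consisting of $ceg$ and its MAC, and no preceding signatures), which gives a signature $s$ recorded in a tuple $\mathrm{signature}(c,\mathit{msg},s,\mathit{time})$, and sends $\mathrm{beaconIni}(@n,c,td,itf,tl,ol,[s],sg)$. - (b6, b7) An AD accepts a beacon addressed to it that is received from its provider, which is either the core of $td$ at the start of a one-hop path or the last AD before it on the path; its ingress interface is the one to that provider. - (b8–b10) It verifies $sg$ with the core's public key, where the core must be the first node of the path, and then recursively, from the last signer back to the core, verifies every signature in $sl$ against the corresponding part of the path, time stamps, hop fields and preceding signatures; if the path and $sl$ are exhausted together it derives $\mathrm{verifiedBeacon}(i,td,itf,tl,ol,sl,sg)$,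 where $itf$ now ends with its ingress interface $ig$. - (b11–b13) For each customer $m$ on interface $eg$ it computes a MAC on $(ig,eg)$, signs the extended beacon (path $itf{+}{+}[eg,m]$, a new time stamp and a new hop field in front) together with the preceding signatures $sl$, records this as a $\mathrm{signature}$ tuple, and sends $\mathrm{beaconFwd}(@m,i,td,itf{+}{+}[eg,m],tl',ol',s::sl,sg)$ with the new signature $s$. - (pc1–pc4) ADs upload verified paths hop by hop to the core, each AD on the way and the core checking the MAC of its own hop field. The relations received from the network are $\mathrm{beaconIni}$, $\mathrm{beaconFwd}$ and $\mathrm{pathUpload}$. The cryptographic functions are arbitrary. *Honesty and signatures.* $\mathrm{Honest}(n)$ means that $n$ runs $\mathit{prog}(n)$ from the beginning of the trace. $\mathrm{verify}(\mathit{msg},s,k)@(n,t)$ means that at time $t$ node $n$ fires a rule in which it successfully checks with key $k$ that $s$ is a signature of $\mathit{msg}$. The signature axiom $A_{sig}$ for a trace is: for all $\mathit{msg},s,k,n,n',t$, if $\mathrm{verify}(\mathit{msg},s,k)@(n,t)$, $\mathrm{publicKeys}(n,n',k)@(n,t)$ and $\mathrm{Honest}(n')$, then $\mathrm{signature}(n',\mathit{msg},s,\cdot)@(n',t')$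 for some $t'<t$. *The property.* $\mathrm{goodInfo}(t,td,ad,sl,itf)$ is defined inductively: 1. $\mathrm{goodInfo}(t,td,ad,s::\mathrm{nil},c::ceg::n::\mathrm{nil})$ holds if $\mathrm{coreTD}(ad,c,td,\mathit{ctf})@(ad,t)$ for some $\mathit{ctf}$ and: $\mathrm{Honest}(c)$ implies $\exists t'\le t$, $\mathrm{customer}(c,n,ceg)@(c,t')$. 2. $\mathrm{goodInfo}(t,td,ad,s'::s::\mathrm{nil},c::ceg::n::nig::neg::m::\mathrm{nil})$ holds if $\mathrm{coreTD}(ad,c,td,\mathit{ctf})@(ad,t)$ for some $\mathit{ctf}$; $\mathrm{Honest}(n)$ implies that for some $t'\le t$, $\mathrm{provider}(n,c,nig)@(n,t')$, $\mathrm{customer}(n,m,neg)@(n,t')$ and $\exists td',tl,ol,sg,s''$, $\mathrm{verifiedBeacon}(n,td',c::ceg::n::nig::\mathrm{nil},tl,ol,s''::\mathrm{nil},sg)@(n,t')$; and $\mathrm{goodInfo}(t,td,ad,s::\mathrm{nil},c::ceg::n::\mathrm{nil})$. 3. $\mathrm{goodInfo}(t,td,ad,s::sl,p'{+}{+}h::hig::heg::n::nig::neg::m::\mathrm{nil})$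 holds if $\mathrm{Honest}(n)$ implies that for some $t'\le t$, $\mathrm{provider}(n,h,nig)@(n,t')$, $\mathrm{customer}(n,m,neg)@(n,t')$ and $\exists td',tl,ol,sg,s'',sl''$, $\mathrm{verifiedBeacon}(n,td',p'{+}{+}h::hig::heg::n::nig::\mathrm{nil},tl,ol,s''::sl'',sg)@(n,t')$; and $\mathrm{goodInfo}(t,td,ad,sl,p'{+}{+}h::hig::heg::n::\mathrm{nil})$. **Theorem.** Let $T$ be any trace that satisfies $A_{sig}$. Then: (b) if a node $n$ starts to run $\mathit{prog}(n)$ at a time $y_b\in\{-\infty\}\cup\mathbb N$ of $T$ (i.e. at time $y_b$ it runs $\mathit{prog}(n)$ and its table and pending list are empty), then for every $y_e$ and every $t$ with $y_b\le t<y_e$, each tuple $\mathrm{beaconIni}(@m,n,td,itf,tl,ol,sl,sg)@(n,t)$ and each tuple $\mathrm{beaconFwd}(@m,n,td,itf,tl,ol,sl,sg)@(n,t)$ satisfies $\mathrm{goodInfo}(t,td,n,sl,itf)$; ($\varphi_{authS}$) for all $n,m,t,td,itf,tl,ol,sl,sg$: if $\mathrm{Honest}(n)$ and $\mathrm{beaconIni}(@m,n,td,itf,tl,ol,sl,sg)@(n,t)$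 or $\mathrm{beaconFwd}(@m,n,td,itf,tl,ol,sl,sg)@(n,t)$, then $\mathrm{goodInfo}(t,td,n,sl,itf)$. -/

import Mathlib

namespace SCION

/-! ### Data -/

/-- Identifiers of autonomous domains (the network nodes; TD cores are nodes too). -/
abbrev AD := ℕ
/-- Identifiers of trust domains. -/
abbrev TD := ℕ
/-- Identifiers of interfaces. -/
abbrev Ifc := ℕ
/-- Time stamps written into beacons. -/
abbrev Stamp := ℕ
abbrev Key := ℕ
abbrev Sig := ℕ
abbrev Mac := ℕ
abbrev Cert := ℕ

/-- Interface fields. A path is laid out by position as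
`c, ceg, n₁, n₁ingress, n₁egress, n₂, n₂ingress, n₂egress, n₃, …`: the core, its egress interface,
the AD to which the core sends, that AD's ingress and egress interface, the next AD, and so on. -/
abbrev Itf := List ℕ

/-- One entry of the list of forwarding fields of a beacon: the interfaces of an AD on the path
(egress for a core; ingress and egress for any other AD) and a MAC on them. -/
structure HopField where
  ifcs : List Ifc
  tag : Mac

/-- The messages that are signed: the global information of a beacon, and the contents of a beacon
(interface field, time stamps, hop fields, and the signatures made by the preceding ADs). -/
inductive Info
  | global (core : AD) (td : TD) (time : Stamp)
  | beacon (itf : Itf) (tl : List Stamp) (ol : List HopField) (sl : List Sig)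

/-- The cryptographic functions. Nothing is assumed about them; the unforgeability of signatures is
a property of traces, see `SigAxiom`. -/
structure Crypto where
  sign : Info → Key → Sig
  verify : Info → Sig → Key → Bool
  mac : List Ifc → Key → Mac
  verifyMac : List Ifc → Mac → Key → Bool

/-! ### Tuples -/

/-- Tuples; the first argument is always the location specifier.
`other` provides the relations of programs different from the SCION program. -/
inductive Tuple
  -- base tuples
  | coreTD (n : AD) (c : AD) (td : TD) (ctf : Cert)
  | provider (n : AD) (m : AD) (ig : Ifc)
  | customer (n : AD) (m : AD) (eg : Ifc)
  | publicKeys (n : AD) (m : AD) (k : Key)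
  | privateKeys (n : AD) (k : Key)
  -- derived tuples
  | signature (n : AD) (info : Info) (sig : Sig) (time : Stamp)
  | mac (n : AD) (ifcs : List Ifc) (tag : Mac)
  | beaconPrep (n : AD) (glb : Info) (sg : Sig) (time : Stamp)
  | beaconIni (m n : AD) (td : TD) (itf : Itf) (tl : List Stamp) (ol : List HopField)
      (sl : List Sig) (sg : Sig)
  | beaconRev (n : AD) (td : TD) (ing : Ifc) (itf : Itf) (tl : List Stamp) (ol : List HopField)
      (sl : List Sig) (sg : Sig)
  | beaconToVeri (n : AD) (td : TD) (itf : Itf) (tl : List Stamp) (ol : List HopField)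
      (sl : List Sig) (sg : Sig) (itfv : Itf) (pos : ℕ)
  | verifiedBeacon (n : AD) (td : TD) (itf : Itf) (tl : List Stamp) (ol : List HopField)
      (sl : List Sig) (sg : Sig)
  | beaconFwd (m n : AD) (td : TD) (itf : Itf) (tl : List Stamp) (ol : List HopField)
      (sl : List Sig) (sg : Sig)
  | upPath (n : AD) (td : TD) (itf : Itf) (opqU : List HopField) (tl : List Stamp)
  | pathUpload (m n src core : AD) (itf : Itf) (opqD opqU : List HopField) (pt : ℕ)
  | downPath (n src : AD) (itf : Itf) (opqD : List HopField)
  | other (n : AD) (name : ℕ) (args : List ℕ)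

/-- Relation names. -/
inductive Rel
  | coreTD | provider | customer | publicKeys | privateKeys | signature | mac | beaconPrep
  | beaconIni | beaconRev | beaconToVeri | verifiedBeacon | beaconFwd | upPath | pathUpload
  | downPath | other (name : ℕ)

/-- The name of the relation to which a tuple belongs. -/
def Tuple.rel : Tuple → Rel
  | coreTD .. => .coreTD
  | provider .. => .provider
  | customer .. => .customer
  | publicKeys .. => .publicKeys
  | privateKeys .. => .privateKeys
  | signature .. => .signature
  | mac .. => .mac
  | beaconPrep .. => .beaconPrep
  | beaconIni .. => .beaconIni
  | beaconRev .. => .beaconRev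
  | beaconToVeri .. => .beaconToVeri
  | verifiedBeacon .. => .verifiedBeacon
  | beaconFwd .. => .beaconFwd
  | upPath .. => .upPath
  | pathUpload .. => .pathUpload
  | downPath .. => .downPath
  | other _ name _ => .other name

/-- The location specifier of a tuple. -/
def Tuple.loc : Tuple → AD
  | coreTD n .. => n
  | provider n .. => n
  | customer n .. => n
  | publicKeys n .. => n
  | privateKeys n .. => n
  | signature n .. => n
  | mac n .. => n
  | beaconPrep n .. => n
  | beaconIni m .. => m
  | beaconRev n .. => n
  | beaconToVeri n .. => n
  | verifiedBeacon n .. => n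
  | beaconFwd m .. => m
  | upPath n .. => n
  | pathUpload m .. => m
  | downPath n .. => n
  | other n .. => n

/-! ### SANDLog programs -/

/-- A signature check `f_verify_asym(info, sig, key) = 1` in the body of a rule. -/
structure Check where
  info : Info
  sig : Sig
  key : Key

/-- A ground instance of a rule: the head, the body tuples in order, and the signature checks of the
body. -/
structure Instance where
  head : Tuple
  body : List Tuple
  checks : List Check := []

/-- A rule is given by its ground instances, i.e. by the substitutions that satisfy the
assignments and inequality constraints of its body. Signature checks are kept in the instances,
because the logic speaks about them; they are evaluated when the rule fires (`firing`). -/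
abbrev Rule := Set Instance

/-- A program: the base tuples, the rules, and the relations which the program receives
from the network (a relation of a program is either local or received). -/
structure Program where
  base : List Tuple
  rules : List Rule
  received : Set Rel

/-! ### Operational semantics -/

/-- Updates: insertions and deletions of tuples. -/
inductive Update
  | ins (p : Tuple)
  | del (p : Tuple)

def Update.tuple : Update → Tuple
  | ins p => p
  | del p => p

/-- A table assigns to every tuple its reference count; a tuple is in the table iff its count is
positive. -/
abbrev Table := Tuple → ℕ

open Classical in
/-- The table after processing an update. -/
noncomputable def Table.apply (Ψ : Table) : Update → Table
  | .ins p => Function.update Ψ p (Ψ p + 1)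
  | .del p => Function.update Ψ p (Ψ p - 1)

/-- The ground instances of the delta rules of `r` that are triggered by the update `u`: some body
tuple is the one being updated, the body tuples before it are in the updated table, those after it
are in the old table, and all signature checks succeed. -/
def firing (F : Crypto) (Ψ : Table) (u : Update) (r : Rule) : Set Instance :=
  {x | x ∈ r ∧
    (∃ l₁ l₂, x.body = l₁ ++ u.tuple :: l₂ ∧
      (∀ p ∈ l₁, 0 < Ψ.apply u p) ∧ (∀ p ∈ l₂, 0 < Ψ p)) ∧
    ∀ c ∈ x.checks, F.verify c.info c.sig c.key = true}

/-- The updates that may be generated when one rule is fired. Which substitutions are selected, and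
which tuples with the same key are then deleted, is left to the implementation; the inserted tuples
are heads of triggered instances. -/
inductive FireSingle (F : Crypto) (Ψ : Table) (r : Rule) : Update → List Update → Prop
  /-- The inserted tuple is already in the table. -/
  | insExists (q : Tuple) : 0 < Ψ q → FireSingle F Ψ r (.ins q) []
  /-- The inserted tuple is new. -/
  | insNew (q : Tuple) (us : List Update) : Ψ q = 0 →
      (∀ p, .ins p ∈ us → ∃ x ∈ firing F Ψ (.ins q) r, p = x.head) →
      (∀ p, .del p ∈ us → ∃ x ∈ firing F Ψ (.ins q) r,
        p.rel = x.head.rel ∧ p.loc = x.head.loc) →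
      FireSingle F Ψ r (.ins q) us
  /-- The deleted tuple has further derivations. -/
  | delExists (q : Tuple) : 1 < Ψ q → FireSingle F Ψ r (.del q) []
  /-- The last copy of a tuple is deleted. -/
  | delNew (q : Tuple) (us : List Update) : Ψ q = 1 →
      (∀ u ∈ us, ∃ x ∈ firing F Ψ (.del q) r, u = .del x.head) →
      FireSingle F Ψ r (.del q) us

/-- The updates generated by firing the rules of a program one after the other. -/
inductive FireRules (F : Crypto) (Ψ : Table) (u : Update) : List Rule → List Update → Prop
  | empty : FireRules F Ψ u [] []
  | seq (r : Rule) (rs : List Rule) (us us' : List Update) :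
      FireSingle F Ψ r u us → FireRules F Ψ u rs us' → FireRules F Ψ u (r :: rs) (us ++ us')

/-- What a node runs: a SANDLog program, or anything at all. The second case models the attacker; it
subsumes the behaviour of arbitrary malicious programs. -/
inductive Behaviour
  | runs (P : Program)
  | arbitrary

/-- Local state of a node. -/
structure LocalState where
  node : AD
  table : Table
  pending : List Update
  behaviour : Behaviour

/-- `LocalState.start n b`: node `n` with an empty table and no pending update. -/
def LocalState.start (n : AD) (b : Behaviour) : LocalState := ⟨n, fun _ => 0, [], b⟩

/-- `LocalStep F S S' Uin Uext`: a step of one node, which generates the updates `Uin` for itself and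
the updates `Uext` for other nodes. -/
inductive LocalStep (F : Crypto) :
    LocalState → LocalState → List Update → List Update → Prop
  /-- The program starts: the base tuples are inserted. -/
  | start (n : AD) (P : Program) : (∀ p ∈ P.base, p.loc = n) →
      LocalStep F (.start n (.runs P)) ⟨n, fun _ => 0, P.base.map .ins, .runs P⟩
        (P.base.map .ins) []
  /-- The first pending update is processed. -/
  | ruleFire (n : AD) (P : Program) (Ψ : Table) (u : Update) (us new : List Update) :
      FireRules F Ψ u P.rules new →
      LocalStep F ⟨n, Ψ, u :: us, .runs P⟩
        ⟨n, Ψ.apply u, us ++ new.filter (fun v => v.tuple.loc = n), .runs P⟩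
        (new.filter (fun v => v.tuple.loc = n)) (new.filter (fun v => v.tuple.loc ≠ n))
  /-- An attacker does anything. -/
  | attack (n : AD) (Ψ Ψ' : Table) (us us' Uin Uext : List Update) :
      LocalStep F ⟨n, Ψ, us, .arbitrary⟩ ⟨n, Ψ', us', .arbitrary⟩ Uin Uext

/-- A configuration of the network: the queue of updates in transit and the local states. -/
structure Config where
  queue : List Update
  state : AD → LocalState

/-- A node running a program only takes from the network tuples of the relations that its program
receives. -/
def Behaviour.accepts : Behaviour → Update → Prop
  | runs P, u => u.tuple.rel ∈ P.received
  | arbitrary, _ => True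

/-- Labels of transitions: a step of a node with the generated updates, or a delivery. -/
inductive Label
  | node (n : AD) (Uin Uext : List Update)
  | deQueue

/-- Transitions of the network. In `deQueue`, every update of the queue is marked as delivered
(`true`) or left in the queue (`false`); a delivered update goes to the node given by its location
specifier. -/
inductive Step (F : Crypto) : Config → Label → Config → Prop
  | node (C : Config) (n : AD) (S' : LocalState) (Uin Uext : List Update) :
      LocalStep F (C.state n) S' Uin Uext →
      Step F C (.node n Uin Uext) ⟨C.queue ++ Uext, Function.update C.state n S'⟩
  | deQueue (C : Config) (d : List (Update × Bool)) :
      C.queue = d.map Prod.fst →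
      (∀ u, (u, true) ∈ d → (C.state u.tuple.loc).behaviour.accepts u) →
      Step F C .deQueue
        ⟨(d.filter (fun v => v.2 = false)).map Prod.fst,
          fun j => { C.state j with
            pending := (C.state j).pending ++
              (d.filter (fun v => v.2 = true ∧ v.1.tuple.loc = j)).map Prod.fst }⟩

/-- A trace: `len` transitions, the `k`-th of which leads from configuration `conf k` to
configuration `conf (k + 1)` at time `time k`. At the beginning no node has started to run. -/
structure Trace (F : Crypto) where
  len : ℕ
  conf : ℕ → Config
  label : ℕ → Label
  time : ℕ → ℕ
  time_mono : Monotone time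
  start : ∀ n, ∃ b, (conf 0).state n = .start n b
  step : ∀ k < len, Step F (conf k) (label k) (conf (k + 1))

/-! ### The SCION program -/

/-- The facts from which the base tuples of a node are made. They describe the topology and the
distribution of keys and depend on the deployment. -/
inductive BaseFact
  | coreTD (c : AD) (td : TD) (ctf : Cert)
  | provider (m : AD) (ig : Ifc)
  | customer (m : AD) (eg : Ifc)
  | publicKeys (m : AD) (k : Key)
  | privateKeys (k : Key)

/-- The base tuple at node `n` given by a fact. -/
def BaseFact.at (n : AD) : BaseFact → Tuple
  | coreTD c td ctf => .coreTD n c td ctf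
  | provider m ig => .provider n m ig
  | customer m eg => .customer n m eg
  | publicKeys m k => .publicKeys n m k
  | privateKeys k => .privateKeys n k

section Rules

variable (F : Crypto) (i : AD)

/-- TD core signs the beacon for customer `nei`. -/
def b1 : Rule := {x | ∃ td ctf nei ceg tag sg time k,
  let info := Info.beacon [i, ceg, nei] [time] [⟨[ceg], tag⟩] []
  x = { head := .signature i info (F.sign info k) time
        body := [.coreTD i i td ctf, .customer i nei ceg,
          .beaconPrep i (.global i td time) sg time, .mac i [ceg] tag, .privateKeys i k] }}

/-- TD core signs the global information of a beacon; `time` is the reading of the clock. -/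
def b2 : Rule := {x | ∃ td ctf time k,
  x = { head := .signature i (.global i td time) (F.sign (.global i td time) k) time
        body := [.coreTD i i td ctf, .privateKeys i k] }}

/-- TD core computes the MAC for its hop field. -/
def b3 : Rule := {x | ∃ td ctf nei ceg k,
  x = { head := .mac i [ceg] (F.mac [ceg] k)
        body := [.coreTD i i td ctf, .customer i nei ceg, .privateKeys i k] }}

/-- TD core prepares the global information of a beacon. -/
def b4 : Rule := {x | ∃ td ctf sg time,
  x = { head := .beaconPrep i (.global i td time) sg time
        body := [.coreTD i i td ctf, .signature i (.global i td time) sg time] }}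

/-- TD core sends a new beacon to customer `nei`. -/
def b5 : Rule := {x | ∃ td ctf nei ceg tag sg sig time,
  x = { head := .beaconIni nei i td [i, ceg, nei] [time] [⟨[ceg], tag⟩] [sig] sg
        body := [.coreTD i i td ctf, .customer i nei ceg,
          .beaconPrep i (.global i td time) sg time, .mac i [ceg] tag,
          .signature i (.beacon [i, ceg, nei] [time] [⟨[ceg], tag⟩] []) sig time] }}

/-- AD receives a beacon from the TD core, which must be its provider. -/
def b6 : Rule := {x | ∃ core td ctf ing ceg tl ol sl sg,
  x = { head := .beaconRev i td ing [core, ceg, i] tl ol sl sg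
        body := [.beaconIni i core td [core, ceg, i] tl ol sl sg, .coreTD i core td ctf,
          .provider i core ing] }}

/-- AD receives a beacon from a non-core AD `nb`, which must be its provider. -/
def b7 : Rule := {x | ∃ nb td ing p hig heg tl ol sl sg,
  x = { head := .beaconRev i td ing (p ++ [nb, hig, heg, i]) tl ol sl sg
        body := [.beaconFwd i nb td (p ++ [nb, hig, heg, i]) tl ol sl sg,
          .provider i nb ing] }}

/-- AD verifies the global information of a received beacon, whose path has to start at the core,
adds its own ingress interface to the path, and starts to verify the signature list. -/
def b8 : Rule := {x | ∃ core td ctf pk ing itf tl ol sl sg time,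
  itf.head? = some core ∧ tl.getLast? = some time ∧
  x = { head := .beaconToVeri i td (itf ++ [ing]) tl ol sl sg itf 0
        body := [.beaconRev i td ing itf tl ol sl sg, .coreTD i core td ctf,
          .publicKeys i core pk]
        checks := [⟨.global core td time, sg, pk⟩] }}

/-- `LastSigner itfv h rest`: an interface field `itfv` is issued by `h` (the core, or the last AD
before the recipient), and `rest` is the interface field that `h` had received (none if `h` is the
core). -/
def LastSigner (itfv : Itf) (h : AD) (rest : Itf) : Prop :=
  (∃ ceg n, itfv = [h, ceg, n] ∧ rest = []) ∨
  (∃ p hig heg n, itfv = p ++ [h, hig, heg, n] ∧ rest = p ++ [h])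

/-- AD recursively verifies the signatures. The lists of time stamps, hop fields and signatures have
the latest entry first; `itfv` is the part of the path that still has to be verified, `pos` the
number of signatures already verified. -/
def b9 : Rule := {x | ∃ td itf tl ol sl sg itfv pos h rest pk sig,
  LastSigner itfv h rest ∧ sl[pos]? = some sig ∧
  x = { head := .beaconToVeri i td itf tl ol sl sg rest (pos + 1)
        body := [.beaconToVeri i td itf tl ol sl sg itfv pos, .publicKeys i h pk]
        checks := [⟨.beacon itfv (tl.drop pos) (ol.drop pos) (sl.drop (pos + 1)), sig, pk⟩] }}

/-- AD validates a beacon when the whole path and all signatures are verified. -/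
def b10 : Rule := {x | ∃ td itf tl ol sl sg,
  x = { head := .verifiedBeacon i td itf tl ol sl sg
        body := [.beaconToVeri i td itf tl ol sl sg [] sl.length] }}

/-- AD signs the new beacon for customer `nei`. -/
def b11 : Rule := {x | ∃ td p ing tl ol sl sg nei eg tag time k,
  let info := Info.beacon (p ++ [ing] ++ [eg, nei]) (time :: tl) (⟨[ing, eg], tag⟩ :: ol) sl
  x = { head := .signature i info (F.sign info k) time
        body := [.verifiedBeacon i td (p ++ [ing]) tl ol sl sg, .customer i nei eg,
          .mac i [ing, eg] tag, .privateKeys i k] }}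

/-- AD computes the MAC for its hop field. -/
def b12 : Rule := {x | ∃ td p ing tl ol sl sg nei eg k,
  x = { head := .mac i [ing, eg] (F.mac [ing, eg] k)
        body := [.verifiedBeacon i td (p ++ [ing]) tl ol sl sg, .customer i nei eg,
          .privateKeys i k] }}

/-- AD sends the new beacon to customer `nei`. -/
def b13 : Rule := {x | ∃ td p ing tl ol sl sg nei eg tag time sig,
  x = { head := .beaconFwd nei i td (p ++ [ing] ++ [eg, nei]) (time :: tl)
          (⟨[ing, eg], tag⟩ :: ol) (sig :: sl) sg
        body := [.verifiedBeacon i td (p ++ [ing]) tl ol sl sg, .customer i nei eg,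
          .mac i [ing, eg] tag,
          .signature i (.beacon (p ++ [ing] ++ [eg, nei]) (time :: tl)
            (⟨[ing, eg], tag⟩ :: ol) sl) sig time] }}

/-- AD extracts path information. -/
def pc1 : Rule := {x | ∃ td itf tl ol sl sg,
  x = { head := .upPath i td itf ol tl
        body := [.verifiedBeacon i td itf tl ol sl sg] }}

/-- AD initiates the upload of a path to the core, through the provider on that path. -/
def pc2 : Rule := {x | ∃ td p ing tl ol core ctf nei,
  x = { head := .pathUpload nei i i core (p ++ [ing]) ol ol 0
        body := [.upPath i td (p ++ [ing]) ol tl, .coreTD i core td ctf,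
          .provider i nei ing] }}

/-- AD checks its own hop field and passes the uploaded path on to its provider. -/
def pc3 : Rule := {x | ∃ m src core itf opqD opqU pt nei ing eg tag k,
  opqU[pt]? = some ⟨[ing, eg], tag⟩ ∧ F.verifyMac [ing, eg] tag k = true ∧
  x = { head := .pathUpload nei i src core itf opqD opqU (pt + 1)
        body := [.pathUpload i m src core itf opqD opqU pt, .provider i nei ing,
          .customer i m eg, .privateKeys i k] }}

/-- TD core checks its own hop field and stores the uploaded path. -/
def pc4 : Rule := {x | ∃ m src itf opqD opqU pt td ctf ceg tag k,
  opqU[pt]? = some ⟨[ceg], tag⟩ ∧ pt + 1 = opqU.length ∧ F.verifyMac [ceg] tag k = true ∧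
  x = { head := .downPath i src itf opqD
        body := [.pathUpload i m src i itf opqD opqU pt, .coreTD i i td ctf,
          .customer i m ceg, .privateKeys i k] }}

/-- The program of node `i` for path construction in SCION; `facts` are the base facts of `i`.
The received relations are those of the rules whose head is located at another node. -/
def prog (facts : List BaseFact) : Program where
  base := facts.map (BaseFact.at i)
  rules := [b1 F i, b2 F i, b3 F i, b4 i, b5 i, b6 i, b7 i, b8 i, b9 i, b10 i, b11 F i, b12 F i,
    b13 i, pc1 i, pc2 i, pc3 F i, pc4 F i]
  received := {.beaconIni, .beaconFwd, .pathUpload}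

end Rules

/-! ### Trace properties -/

section Properties

variable {F : Crypto}

/-- `p@(n, t)`: node `n` has derived the tuple `p` at a time no later than `t`. -/
def Derived (T : Trace F) (p : Tuple) (n : AD) (t : ℕ) : Prop :=
  ∃ k < T.len, T.time k ≤ t ∧ ∃ Uin Uext, T.label k = .node n Uin Uext ∧
    (.ins p ∈ Uin ∨ .ins p ∈ Uext)

/-- `verify(m, s, k)@(n, t)`: at time `t`, node `n` fires a rule in whose body it checks
successfully, with the key `k`, that `s` is a signature of `m`. -/
def Verifies (T : Trace F) (m : Info) (s : Sig) (k : Key) (n : AD) (t : ℕ) : Prop :=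
  ∃ j < T.len, T.time j = t ∧ (∃ Uin Uext, T.label j = .node n Uin Uext) ∧
    ∃ P Ψ q us, (T.conf j).state n = ⟨n, Ψ, .ins q :: us, .runs P⟩ ∧ Ψ q = 0 ∧
      ∃ r ∈ P.rules, ∃ x ∈ firing F Ψ (.ins q) r, ⟨m, s, k⟩ ∈ x.checks

/-- `honest(n, P, τ)`: at time `τ` the node `n` starts to run `P`, i.e. it runs `P` and its local
state at time `τ` has an empty table and no pending update. The time `⊥` is the earliest one. -/
def HonestFrom (T : Trace F) (n : AD) (P : Program) (τ : WithBot ℕ) : Prop :=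
  ∃ k ≤ T.len, (∀ j < k, (T.time j : WithBot ℕ) ≤ τ) ∧
    (∀ j < T.len, k ≤ j → τ ≤ (T.time j : WithBot ℕ)) ∧
    (T.conf k).state n = .start n (.runs P)

/-- `Honest(n)`: node `n` runs the SCION program from the beginning. `facts n` are the base facts
of `n`. -/
def Honest (T : Trace F) (facts : AD → List BaseFact) (n : AD) : Prop :=
  HonestFrom T n (prog F n (facts n)) ⊥

/-- The axiom of signatures: if a node verifies a signature with the public key of an honest node
`n'`, then `n'` has generated that signature before. -/
def SigAxiom (T : Trace F) (facts : AD → List BaseFact) : Prop :=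
  ∀ (m : Info) (s : Sig) (k : Key) (n n' : AD) (t : ℕ),
    Verifies T m s k n t → Derived T (.publicKeys n n' k) n t → Honest T facts n' →
      ∃ t' < t, ∃ time, Derived T (.signature n' m s time) n' t'

/-- `GoodInfo T facts t td ad sl itf`: up to time `t`, every honest AD on the interface field `itf`
has the links to its provider and its customer stated there, every honest non-core AD has a verified
beacon for the path from the core to it, and `ad` knows the first node as a core of `td`. -/
inductive GoodInfo (T : Trace F) (facts : AD → List BaseFact) (t : ℕ) (td : TD) (ad : AD) :
    List Sig → Itf → Prop
  /-- The core `c` sends to `n`. -/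
  | core (c ceg n ctf s : ℕ) :
      Derived T (.coreTD ad c td ctf) ad t →
      (Honest T facts c → ∃ t' ≤ t, Derived T (.customer c n ceg) c t') →
      GoodInfo T facts t td ad [s] [c, ceg, n]
  /-- The AD `n`, whose provider is the core `c`, sends to `m`. -/
  | first (c ceg n nig neg m ctf s s' : ℕ) :
      Derived T (.coreTD ad c td ctf) ad t →
      (Honest T facts n → ∃ t' ≤ t,
        Derived T (.provider n c nig) n t' ∧ Derived T (.customer n m neg) n t' ∧
        ∃ td' tl ol sg s'', Derived T
          (.verifiedBeacon n td' [c, ceg, n, nig] tl ol [s''] sg) n t') →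
      GoodInfo T facts t td ad [s] [c, ceg, n] →
      GoodInfo T facts t td ad [s', s] [c, ceg, n, nig, neg, m]
  /-- The AD `n`, whose provider is the non-core AD `h`, sends to `m`. -/
  | later (p' : Itf) (h hig heg n nig neg m s : ℕ) (sl : List Sig) :
      (Honest T facts n → ∃ t' ≤ t,
        Derived T (.provider n h nig) n t' ∧ Derived T (.customer n m neg) n t' ∧
        ∃ td' tl ol sg s'' sl'', Derived T
          (.verifiedBeacon n td' (p' ++ [h, hig, heg, n, nig]) tl ol (s'' :: sl'') sg) n t') →
      GoodInfo T facts t td ad sl (p' ++ [h, hig, heg, n]) →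
      GoodInfo T facts t td ad (s :: sl) (p' ++ [h, hig, heg, n, nig, neg, m])

/-- The program invariant, interpreted on the trace: whichever node `n` starts the SCION program at
time `τb`, the beacons derived by `n` at a time in `[τb, τe)` satisfy `GoodInfo`. -/
def BeaconInvariant (T : Trace F) (facts : AD → List BaseFact) : Prop :=
  ∀ (n : AD) (τb : WithBot ℕ) (τe : ℕ), HonestFrom T n (prog F n (facts n)) τb →
    ∀ (t : ℕ) (m : AD) (td : TD) (itf : Itf) (tl : List Stamp) (ol : List HopField)
      (sl : List Sig) (sg : Sig), τb ≤ (t : WithBot ℕ) → t < τe →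
      (Derived T (.beaconIni m n td itf tl ol sl sg) n t → GoodInfo T facts t td n sl itf) ∧
      (Derived T (.beaconFwd m n td itf tl ol sl sg) n t → GoodInfo T facts t td n sl itf)

/-- Route authenticity. -/
def RouteAuthenticity (T : Trace F) (facts : AD → List BaseFact) : Prop :=
  ∀ (n m : AD) (t : ℕ) (td : TD) (itf : Itf) (tl : List Stamp) (ol : List HopField)
    (sl : List Sig) (sg : Sig),
    Honest T facts n →
    (Derived T (.beaconIni m n td itf tl ol sl sg) n t ∨
      Derived T (.beaconFwd m n td itf tl ol sl sg) n t) →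
    GoodInfo T facts t td n sl itf

end Properties

end SCION

namespace SCION

/-! A tuple known to a node that runs the program is either of a received relation, in which case
its origin may be an attacker, or was generated earlier by the node itself
(`RunsProgram.received_or_genAt`). So every derived tuple of an honest node can be traced back
through the rules, as long as only the local body tuples are trusted. An honest node that verifies a
beacon has checked one signature for each issuer on the path. If an issuer is honest, the signature
axiom says that it made this signature, and inverting the signing rules shows that it had the stated
customer link and, when it extends a path, a verified beacon for the preceding part (`Issued`). This
gives a `SignedPath` (`GenAt.signedPath`). The argument is not circular: `Issued` says nothing about
the signatures inside the beacon that the issuer verified. Applying the same result to the issuer's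
own verified beacon yields its provider link (`Issued.links`), and induction along the signed path
gives `GoodInfo` (`SignedPath.goodInfo`). A signed path has three entries per signature, which
excludes every misaligned reading of the interface field. Behaviours never change, so a node that
starts the program at any time is honest from the beginning; the invariant and route authenticity
thus rest on the same two statements about beacons. -/

variable {F : Crypto}

/-! ### Generated tuples, and the constancy of names and behaviours -/

/-- At step `k`, node `n` generates the insertion of `p`. -/
def GenAt (T : Trace F) (n : AD) (p : Tuple) (k : ℕ) : Prop :=
  k < T.len ∧ ∃ Uin Uext, T.label k = .node n Uin Uext ∧ (.ins p ∈ Uin ∨ .ins p ∈ Uext)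

theorem GenAt.derived {T : Trace F} {n : AD} {p : Tuple} {k t : ℕ} (h : GenAt T n p k)
    (ht : T.time k ≤ t) : Derived T p n t :=
  ⟨k, h.1, ht, h.2⟩

theorem Derived.exists_genAt {T : Trace F} {n : AD} {p : Tuple} {t : ℕ} (h : Derived T p n t) :
    ∃ k, T.time k ≤ t ∧ GenAt T n p k := by
  obtain ⟨k, hk, ht, h⟩ := h
  exact ⟨k, ht, hk, h⟩

theorem LocalStep.node_eq {S S' : LocalState} {Ui Ue : List Update}
    (h : LocalStep F S S' Ui Ue) : S'.node = S.node := by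
  cases h <;> rfl

theorem LocalStep.behaviour_eq {S S' : LocalState} {Ui Ue : List Update}
    (h : LocalStep F S S' Ui Ue) : S'.behaviour = S.behaviour := by
  cases h <;> rfl

theorem Step.behaviour_eq {C C' : Config} {l : Label} (h : Step F C l C') (n : AD) :
    (C'.state n).behaviour = (C.state n).behaviour := by
  cases h with
  | node m S' Ui Ue hs =>
    by_cases e : n = m
    · subst e; simpa using hs.behaviour_eq
    · simp [Function.update_of_ne e]
  | deQueue d h1 h2 => rfl

theorem Step.node_eq {C C' : Config} {l : Label} (h : Step F C l C') (n : AD) :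
    (C'.state n).node = (C.state n).node := by
  cases h with
  | node m S' Ui Ue hs =>
    by_cases e : n = m
    · subst e; simpa using hs.node_eq
    · simp [Function.update_of_ne e]
  | deQueue d h1 h2 => rfl

theorem Trace.behaviour_eq (T : Trace F) (n : AD) {k : ℕ} (hk : k ≤ T.len) :
    ((T.conf k).state n).behaviour = ((T.conf 0).state n).behaviour := by
  induction k with
  | zero => rfl
  | succ k ih => rw [(T.step k hk).behaviour_eq, ih (Nat.le_of_succ_le hk)]

theorem Trace.node_eq (T : Trace F) (n : AD) {k : ℕ} (hk : k ≤ T.len) :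
    ((T.conf k).state n).node = n := by
  induction k with
  | zero => obtain ⟨b, hb⟩ := T.start n; rw [hb]; rfl
  | succ k ih => rw [(T.step k hk).node_eq, ih (Nat.le_of_succ_le hk)]

/-- Node `n` runs the program `P` throughout the trace. -/
def RunsProgram (T : Trace F) (n : AD) (P : Program) : Prop :=
  ∀ k ≤ T.len, ((T.conf k).state n).behaviour = .runs P

theorem HonestFrom.runsProgram {T : Trace F} {n : AD} {P : Program} {τ : WithBot ℕ}
    (h : HonestFrom T n P τ) : RunsProgram T n P := by
  obtain ⟨k, hk, -, -, hs⟩ := h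
  intro j hj
  -- The comparison passes through configuration `0`, since `j` may precede the start `k`.
  rw [T.behaviour_eq n hj, ← T.behaviour_eq n hk, hs]
  rfl

/-- Behaviours never change, and no node has started in the first configuration: a node that starts
a program at some time runs it from the beginning. -/
theorem HonestFrom.of_bot {T : Trace F} {n : AD} {P : Program} {τ : WithBot ℕ}
    (h : HonestFrom T n P τ) : HonestFrom T n P ⊥ := by
  refine ⟨0, Nat.zero_le _, by simp, by simp, ?_⟩
  obtain ⟨b, hb⟩ := T.start n
  have := h.runsProgram 0 (Nat.zero_le _)
  rw [hb] at this ⊢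
  change b = _ at this
  rw [this]

/-! ### Provenance of the tuples of a node that runs a program -/

/-- Deletions emit only deletions, and inserting a present tuple emits nothing. The conclusion `Ψ q
= 0` is kept because `Verifies` asks for it. -/
theorem FireSingle.exists_firing {Ψ : Table} {r : Rule} {u : Update} {us : List Update} {p : Tuple}
    (h : FireSingle F Ψ r u us) (hp : .ins p ∈ us) :
    ∃ q, u = .ins q ∧ Ψ q = 0 ∧ ∃ x ∈ firing F Ψ u r, p = x.head := by
  cases h with
  | insExists q h => simp at hp
  | insNew q us h0 h1 h2 => exact ⟨q, rfl, h0, h1 p hp⟩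
  | delExists q h => simp at hp
  | delNew q us h0 h1 =>
    obtain ⟨x, -, hx⟩ := h1 _ hp
    cases hx

theorem FireRules.exists_firing {Ψ : Table} {u : Update} {rs : List Rule} {us : List Update}
    {p : Tuple} (h : FireRules F Ψ u rs us) (hp : .ins p ∈ us) :
    ∃ q, u = .ins q ∧ Ψ q = 0 ∧ ∃ r ∈ rs, ∃ x ∈ firing F Ψ u r, p = x.head := by
  induction h with
  | empty => simp at hp
  | seq r rs us us' h1 h2 ih =>
    rcases List.mem_append.1 hp with hp | hp
    · obtain ⟨q, e, h0, x, hx⟩ := h1.exists_firing hp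
      exact ⟨q, e, h0, r, by simp, x, hx⟩
    · obtain ⟨q, e, h0, r', hr, hx⟩ := ih hp
      exact ⟨q, e, h0, r', by simp [hr], hx⟩

theorem Table.pos_of_apply_pos {Ψ : Table} {u : Update} {p : Tuple} (h : 0 < Ψ.apply u p) :
    0 < Ψ p ∨ u = .ins p := by
  classical
  cases u with
  | ins q =>
    by_cases e : p = q
    · exact .inr (by rw [e])
    · left; simpa [Table.apply, Function.update_of_ne e] using h
  | del q =>
    left
    by_cases e : p = q
    · subst e
      simp [Table.apply] at h
      omega
    · simpa [Table.apply, Function.update_of_ne e] using h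

/-- The tuples known to a node running `P`: those in its table or pending to be inserted. -/
def LocalState.Knows (S : LocalState) (p : Tuple) : Prop :=
  0 < S.table p ∨ .ins p ∈ S.pending

/-- Processing an insertion only moves its tuple from the pending list to the table, and a deletion
only lowers a count. This is why `Knows` counts pending insertions: a local step can add to it only
what the node generates for itself. -/
theorem LocalStep.knows {S S' : LocalState} {Ui Ue : List Update} {P : Program} {p : Tuple}
    (h : LocalStep F S S' Ui Ue) (hP : S.behaviour = .runs P) (hp : S'.Knows p) :
    S.Knows p ∨ .ins p ∈ Ui := by
  cases h with
  | start n Q hQ =>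
    rcases hp with hp | hp
    · simp at hp
    · exact .inr hp
  | ruleFire n Q Ψ u us new hf =>
    rcases hp with hp | hp
    · rcases Table.pos_of_apply_pos hp with h | h
      · exact .inl (.inl h)
      · exact .inl (.inr (by simp [h]))
    · rcases List.mem_append.1 hp with h | h
      · exact .inl (.inr (by simp [h]))
      · exact .inr h
  | attack => cases hP

/-- The only further source is a delivery, and there `Behaviour.accepts` restricts the relation. -/
theorem Step.knows {C C' : Config} {l : Label} {P : Program} {n : AD} {p : Tuple}
    (h : Step F C l C') (hP : (C.state n).behaviour = .runs P) (hp : (C'.state n).Knows p) :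
    (C.state n).Knows p ∨ p.rel ∈ P.received ∨
      ∃ Uin Uext, l = .node n Uin Uext ∧ .ins p ∈ Uin := by
  cases h with
  | node m S' Ui Ue hs =>
    by_cases e : n = m
    · subst e
      simp only [Function.update_self] at hp
      rcases hs.knows hP hp with h | h
      · exact .inl h
      · exact .inr (.inr ⟨Ui, Ue, rfl, h⟩)
    · simp only [Function.update_of_ne e] at hp
      exact .inl hp
  | deQueue d h1 h2 =>
    rcases hp with hp | hp
    · exact .inl (.inl hp)
    · rcases List.mem_append.1 hp with hp | hp
      · exact .inl (.inr hp)
      · right; left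
        obtain ⟨⟨u, b⟩, hv, e⟩ := List.mem_map.1 hp
        simp only [List.mem_filter, decide_eq_true_eq] at hv
        obtain ⟨hv, rfl, hl⟩ := hv
        have := h2 u hv
        rw [hl, hP] at this
        simp only at e
        subst e
        exact this

/-- A tuple known to a node that runs `P` was received from the network or generated by the node
itself at an earlier step. -/
theorem RunsProgram.received_or_genAt {T : Trace F} {n : AD} {P : Program} (hr : RunsProgram T n P)
    {k : ℕ} (hk : k ≤ T.len) {p : Tuple} (hp : ((T.conf k).state n).Knows p) :
    p.rel ∈ P.received ∨ ∃ j < k, GenAt T n p j := by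
  induction k with
  | zero =>
    obtain ⟨b, hb⟩ := T.start n
    rw [hb] at hp
    simp [LocalState.Knows, LocalState.start] at hp
  | succ k ih =>
    rcases (T.step k hk).knows (hr k (by omega)) hp with h | h | ⟨Ui, Ue, hl, h⟩
    · rcases ih (by omega) h with h | ⟨j, hj, h⟩
      · exact .inl h
      · exact .inr ⟨j, by omega, h⟩
    · exact .inl h
    · exact .inr ⟨k, by omega, hk, Ui, Ue, hl, .inl h⟩

/-- A tuple generated at step `k` is a base tuple or the head of a rule instance whose body tuples
were known before and whose signature checks are performed at step `k`. -/
theorem GenAt.base_or_rule {T : Trace F} {n : AD} {P : Program} {p : Tuple} {k : ℕ}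
    (h : GenAt T n p k) (hr : RunsProgram T n P) :
    p ∈ P.base ∨ ∃ r ∈ P.rules, ∃ x ∈ r, p = x.head ∧
      (∀ b ∈ x.body, b.rel ∈ P.received ∨ ∃ j < k, GenAt T n b j) ∧
      ∀ c ∈ x.checks, Verifies T c.info c.sig c.key n (T.time k) := by
  obtain ⟨hk, Ui, Ue, hl, hp⟩ := h
  have hst := T.step k hk
  have hb := hr k hk.le
  have hn := T.node_eq n hk.le
  have hknow := fun b => hr.received_or_genAt (p := b) hk.le
  generalize hS : (T.conf k).state n = S at hb hn hknow
  have hloc : ∃ S', LocalStep F S S' Ui Ue := by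
    rw [hl] at hst
    generalize T.conf k = C at hst hS
    generalize T.conf (k + 1) = C' at hst
    cases hst with
    | node m S' Ui Ue hs => exact ⟨S', hS ▸ hs⟩
  obtain ⟨S', hloc⟩ := hloc
  cases hloc with
  | start m Q hQ =>
    cases hb
    left
    rcases hp with hp | hp
    · simpa using hp
    · simp at hp
  | ruleFire m Q Ψ u us new hf =>
    cases hb
    cases hn
    right
    have hp' : Update.ins p ∈ new := by
      rcases hp with hp | hp <;> exact (List.mem_filter.1 hp).1
    obtain ⟨q, rfl, h0, r, hrr, x, hx, e⟩ := hf.exists_firing hp'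
    refine ⟨r, hrr, x, hx.1, e, ?_, ?_⟩
    · intro b hbb
      apply hknow
      obtain ⟨l₁, l₂, e, h1, h2⟩ := hx.2.1
      rw [e] at hbb
      -- The triggering tuple is not yet in the table; it is known as the first pending update.
      have hq : ∀ c, c = q → LocalState.Knows ⟨m, Ψ, .ins q :: us, .runs P⟩ c := by
        rintro _ rfl
        exact .inr (by simp)
      rcases List.mem_append.1 hbb with h | h
      · rcases Table.pos_of_apply_pos (h1 b h) with h | h
        · exact .inl h
        · exact hq b (by cases h; rfl)
      · rcases List.mem_cons.1 h with h | h
        · exact hq b h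
        · exact .inl (h2 b h)
    · intro c hc
      exact ⟨k, hk, rfl, ⟨_, _, hl⟩, P, Ψ, q, us, hS, h0, r, hrr, x, hx, hc⟩
  | attack => cases hb

/-! ### Inversion of the SCION rules -/

/-- The relations of the base tuples of the SCION program. -/
def Rel.IsBase : Rel → Prop
  | coreTD | provider | customer | publicKeys | privateKeys => True
  | _ => False

/-- The relations received by the SCION program. -/
def Rel.IsReceived : Rel → Prop
  | beaconIni | beaconFwd | pathUpload => True
  | _ => False

theorem BaseFact.isBase_rel_at (n : AD) (f : BaseFact) : (f.at n).rel.IsBase := by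
  cases f <;> trivial

theorem isReceived_of_mem_received {n : AD} {fs : List BaseFact} {ρ : Rel}
    (h : ρ ∈ (prog F n fs).received) : ρ.IsReceived := by
  rcases h with rfl | rfl | rfl <;> trivial

/-- The instances of the rules of the beacon part of the program whose head is of a given
relation. -/
def rulesDeriving (F : Crypto) (i : AD) : Rel → Set Instance
  | .signature => b1 F i ∪ (b2 F i ∪ b11 F i)
  | .beaconIni => b5 i
  | .beaconRev => b6 i ∪ b7 i
  | .beaconToVeri => b8 i ∪ b9 i
  | .verifiedBeacon => b10 i
  | .beaconFwd => b13 i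
  | _ => Set.univ

/-- Each rule has heads of one relation only, so later inversions face at most three rules instead
of seventeen. Relations that are never inverted carry `Set.univ`, whence the `trivial` cases. -/
theorem mem_rulesDeriving {i : AD} {fs : List BaseFact} {r : Rule} {x : Instance}
    (hr : r ∈ (prog F i fs).rules) (hx : x ∈ r) : x ∈ rulesDeriving F i x.head.rel := by
  have hx' := hx
  simp only [prog, List.mem_cons, List.not_mem_nil, or_false] at hr
  rcases hr with rfl | rfl | rfl | rfl | rfl | rfl | rfl | rfl | rfl | rfl | rfl | rfl | rfl | rfl |
    rfl | rfl | rfl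
  · obtain ⟨_, _, _, _, _, _, _, _, rfl⟩ := hx'
    exact .inl hx
  · obtain ⟨_, _, _, _, rfl⟩ := hx'
    exact .inr (.inl hx)
  · obtain ⟨_, _, _, _, _, rfl⟩ := hx'
    trivial
  · obtain ⟨_, _, _, _, rfl⟩ := hx'
    trivial
  · obtain ⟨_, _, _, _, _, _, _, _, rfl⟩ := hx'
    exact hx
  · obtain ⟨_, _, _, _, _, _, _, _, _, rfl⟩ := hx'
    exact .inl hx
  · obtain ⟨_, _, _, _, _, _, _, _, _, _, rfl⟩ := hx'
    exact .inr hx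
  · obtain ⟨_, _, _, _, _, _, _, _, _, _, _, _, _, rfl⟩ := hx'
    exact .inl hx
  · obtain ⟨_, _, _, _, _, _, _, _, _, _, _, _, _, _, rfl⟩ := hx'
    exact .inr hx
  · obtain ⟨_, _, _, _, _, _, rfl⟩ := hx'
    exact hx
  · obtain ⟨_, _, _, _, _, _, _, _, _, _, _, _, rfl⟩ := hx'
    exact .inr (.inr hx)
  · obtain ⟨_, _, _, _, _, _, _, _, _, _, rfl⟩ := hx'
    trivial
  · obtain ⟨_, _, _, _, _, _, _, _, _, _, _, _, rfl⟩ := hx'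
    exact hx
  · obtain ⟨_, _, _, _, _, _, rfl⟩ := hx'
    trivial
  · obtain ⟨_, _, _, _, _, _, _, _, rfl⟩ := hx'
    trivial
  · obtain ⟨_, _, _, _, _, _, _, _, _, _, _, _, _, _, rfl⟩ := hx'
    trivial
  · obtain ⟨_, _, _, _, _, _, _, _, _, _, _, _, _, _, rfl⟩ := hx'
    trivial

variable {T : Trace F} {facts : AD → List BaseFact} {n : AD}

/-- A derived tuple of an honest node is the head of a rule instance of the SCION program. -/
theorem GenAt.exists_rule {p : Tuple} {k : ℕ}
    (h : GenAt T n p k) (hn : Honest T facts n) (hp : ¬ p.rel.IsBase) :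
    ∃ x ∈ rulesDeriving F n p.rel, p = x.head ∧
      (∀ b ∈ x.body, ¬ b.rel.IsReceived → ∃ j < k, GenAt T n b j) ∧
      ∀ c ∈ x.checks, Verifies T c.info c.sig c.key n (T.time k) := by
  rcases h.base_or_rule hn.runsProgram with hb | ⟨r, hr, x, hx, e, h1, h2⟩
  · obtain ⟨f, -, rfl⟩ := List.mem_map.1 hb
    exact absurd (f.isBase_rel_at n) hp
  · exact ⟨x, e ▸ mem_rulesDeriving hr hx, e,
      fun b hb hbr => (h1 b hb).resolve_left fun h => hbr (isReceived_of_mem_received h), h2⟩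

/-- A derived tuple of an honest node is the head of a rule instance of the SCION program whose
local body tuples were derived no later. -/
theorem Derived.exists_rule {p : Tuple} {t : ℕ}
    (h : Derived T p n t) (hn : Honest T facts n) (hp : ¬ p.rel.IsBase) :
    ∃ x ∈ rulesDeriving F n p.rel, p = x.head ∧
      ∀ b ∈ x.body, ¬ b.rel.IsReceived → Derived T b n t := by
  obtain ⟨k, hk, h⟩ := h.exists_genAt
  obtain ⟨x, hx, e, hb, -⟩ := h.exists_rule hn hp
  refine ⟨x, hx, e, fun b hbb hbr => ?_⟩
  obtain ⟨j, hj, h⟩ := hb b hbb hbr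
  exact h.derived ((T.time_mono hj.le).trans hk)

/-! ### What an honest node guarantees about the paths it receives and signs -/

/-- `ReceivedFrom T n t ing itf`: the interface field `itf` is addressed to `n` by a provider of `n`
on the interface `ing`. -/
def ReceivedFrom (T : Trace F) (n : AD) (t : ℕ) (ing : Ifc) (itf : Itf) : Prop :=
  (∃ c ceg, itf = [c, ceg, n] ∧ Derived T (.provider n c ing) n t) ∨
  ∃ p h hig heg, itf = p ++ [h, hig, heg, n] ∧ Derived T (.provider n h ing) n t

/-- The received beacon in the body of `b6` or `b7` may come from an attacker; what remains is the
shape of the path and the local `provider` tuple. -/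
theorem Derived.receivedFrom {t : ℕ} {td : TD} {ing : Ifc} {itf : Itf} {tl : List Stamp}
    {ol : List HopField} {sl : List Sig} {sg : Sig}
    (h : Derived T (.beaconRev n td ing itf tl ol sl sg) n t) (hn : Honest T facts n) :
    ReceivedFrom T n t ing itf := by
  obtain ⟨x, hx, e, hb⟩ := h.exists_rule hn (by simp [Tuple.rel, Rel.IsBase])
  rcases hx with ⟨_, _, _, _, _, _, _, _, _, rfl⟩ | ⟨_, _, _, _, _, _, _, _, _, _, rfl⟩
  · cases e
    exact .inl ⟨_, _, rfl, hb _ (by simp) (by simp [Tuple.rel, Rel.IsReceived])⟩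
  · cases e
    exact .inr ⟨_, _, _, _, rfl, hb _ (by simp) (by simp [Tuple.rel, Rel.IsReceived])⟩

/-- `Issued T h t itfv`: the node `h` has a customer link as stated at the end of `itfv`, and
`itfv` is either a new path or extends the path of a beacon that `h` has verified. -/
def Issued (T : Trace F) (h : AD) (t : ℕ) (itfv : Itf) : Prop :=
  (∃ nei ceg, itfv = [h, ceg, nei] ∧ Derived T (.customer h nei ceg) h t) ∨
  ∃ p ing eg nei td tl ol sl sg, itfv = p ++ [ing, eg, nei] ∧
    Derived T (.customer h nei eg) h t ∧
    Derived T (.verifiedBeacon h td (p ++ [ing]) tl ol sl sg) h t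

/-- An honest node only signs beacons that it issues. -/
theorem Derived.issued_of_signature {t : ℕ} {itf : Itf} {tl : List Stamp} {ol : List HopField}
    {sl : List Sig} {sig : Sig} {time : Stamp}
    (h : Derived T (.signature n (.beacon itf tl ol sl) sig time) n t) (hn : Honest T facts n) :
    Issued T n t itf := by
  obtain ⟨x, hx, e, hb⟩ := h.exists_rule hn (by simp [Tuple.rel, Rel.IsBase])
  rcases hx with ⟨_, _, _, _, _, _, _, _, rfl⟩ | ⟨_, _, _, _, rfl⟩ |
    ⟨td, p, ing, tl, ol, sl, sg, nei, eg, _, _, _, rfl⟩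
  · cases e
    exact .inl ⟨_, _, rfl, hb _ (by simp) (by simp [Tuple.rel, Rel.IsReceived])⟩
  · cases e
  · cases e
    exact .inr ⟨p, ing, eg, nei, td, tl, ol, sl, sg, by simp,
      hb _ (by simp) (by simp [Tuple.rel, Rel.IsReceived]),
      hb _ (by simp) (by simp [Tuple.rel, Rel.IsReceived])⟩

/-! ### Signed paths and the recursive verification -/

/-- `SignedPath T facts t itfv k`: going back from the end of `itfv` to the core, there are `k`
issuers, and the honest ones have issued the corresponding part of the path by time `t`. -/
inductive SignedPath (T : Trace F) (facts : AD → List BaseFact) (t : ℕ) : Itf → ℕ → Prop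
  | nil : SignedPath T facts t [] 0
  | cons (itfv : Itf) (h : AD) (rest : Itf) (k : ℕ) : LastSigner itfv h rest →
      (Honest T facts h → ∃ t' ≤ t, Issued T h t' itfv) →
      SignedPath T facts t rest k → SignedPath T facts t itfv (k + 1)

/-- What `n` knows by time `t` about a beacon received on the interface `ing` whose verification has
begun. -/
def ReceivedBeacon (T : Trace F) (n : AD) (t : ℕ) (td : TD) (ing : Ifc) (itf : Itf) : Prop :=
  ReceivedFrom T n t ing itf ∧
    ∃ core ctf, itf.head? = some core ∧ Derived T (.coreTD n core td ctf) n t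

/-- Verification starts at the last signer, so the part `itfv` still to be checked is the tail of
the desired derivation. The conclusion is therefore an implication: it is the identity at `b8`, and
each `b9` supplies one more application of `SignedPath.cons`. The induction follows the chain of
`b9` steps back to `b8`. -/
theorem GenAt.signedPath (hsig : SigAxiom T facts) (hn : Honest T facts n) {td : TD}
    {itf : Itf} {tl : List Stamp} {ol : List HopField} {sl : List Sig} {sg : Sig} {t k : ℕ}
    (ht : T.time k ≤ t) {itfv : Itf} {pos : ℕ}
    (h : GenAt T n (.beaconToVeri n td itf tl ol sl sg itfv pos) k) :
    ∃ itf' ing, itf = itf' ++ [ing] ∧ ReceivedBeacon T n t td ing itf' ∧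
      ∀ m, SignedPath T facts t itfv m → SignedPath T facts t itf' (m + pos) := by
  induction k using Nat.strong_induction_on generalizing itfv pos with
  | _ k ih =>
  obtain ⟨x, hx, e, hb, hc⟩ := h.exists_rule hn (by simp [Tuple.rel, Rel.IsBase])
  have hb' : ∀ b ∈ x.body, ¬ b.rel.IsReceived → Derived T b n t := fun b hbb hbr => by
    obtain ⟨j, hj, h⟩ := hb b hbb hbr
    exact h.derived ((T.time_mono hj.le).trans ht)
  rcases hx with ⟨core, _, ctf, _, ing, itf', _, _, _, _, _, hcore, -, rfl⟩ |
    ⟨_, _, _, _, _, _, _, _, q, _, pk, _, hls, -, rfl⟩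
  · cases e
    refine ⟨_, ing, rfl, ⟨?_, core, ctf, hcore, ?_⟩, fun m hm => hm⟩
    · exact (hb' (.beaconRev ..) (List.mem_cons_self ..)
        (by simp [Tuple.rel, Rel.IsReceived])).receivedFrom hn
    · exact hb' _ (by simp) (by simp [Tuple.rel, Rel.IsReceived])
  · cases e
    obtain ⟨j, hj, h⟩ := hb (.beaconToVeri ..) (List.mem_cons_self ..)
      (by simp [Tuple.rel, Rel.IsReceived])
    obtain ⟨itf', ing, e, hrec, hpath⟩ := ih j hj ((T.time_mono hj.le).trans ht) h
    refine ⟨itf', ing, e, hrec, fun m hm => ?_⟩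
    -- `m + (pos + 1)` becomes `(m + 1) + pos`: the issuer just checked moves from the verified part
    -- to the remainder.
    rw [← add_assoc, add_right_comm]
    refine hpath _ (.cons _ q _ m hls (fun hq => ?_) hm)
    obtain ⟨j', hj', hpk⟩ := hb (.publicKeys n q pk) (by simp)
      (by simp [Tuple.rel, Rel.IsReceived])
    -- The check takes place at step `k`, and the key was derived at the earlier step `j'`, hence no
    -- later than `T.time k`, as the axiom requires.
    obtain ⟨t', ht', time, hs⟩ := hsig _ _ _ n q (T.time k) (hc _ (List.mem_singleton_self _))
      (hpk.derived (T.time_mono hj'.le)) hq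
    exact ⟨t', by omega, hs.issued_of_signature hq⟩

/-- The whole path of a verified beacon is signed, with as many signatures as there are in the
beacon. -/
theorem Derived.signedPath (hsig : SigAxiom T facts) (hn : Honest T facts n) {td : TD}
    {itf : Itf} {tl : List Stamp} {ol : List HopField} {sl : List Sig} {sg : Sig} {t : ℕ}
    (h : Derived T (.verifiedBeacon n td itf tl ol sl sg) n t) :
    ∃ itf' ing, itf = itf' ++ [ing] ∧ ReceivedBeacon T n t td ing itf' ∧
      SignedPath T facts t itf' sl.length := by
  obtain ⟨x, hx, e, hb⟩ := h.exists_rule hn (by simp [Tuple.rel, Rel.IsBase])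
  obtain ⟨_, _, _, _, _, _, rfl⟩ := hx
  cases e
  obtain ⟨k, hk, h⟩ := (hb (.beaconToVeri ..) (List.mem_cons_self ..)
    (by simp [Tuple.rel, Rel.IsReceived])).exists_genAt
  obtain ⟨itf', ing, e, hrec, hpath⟩ := h.signedPath hsig hn hk
  -- Rule `b10` fires with an exhausted path and `pos = sl.length`, so the empty remainder closes
  -- the derivation.
  exact ⟨itf', ing, e, hrec, by simpa using hpath 0 .nil⟩

/-! ### Alignment of paths, and the links of an honest issuer -/

/-- Every issuer adds exactly three entries. `LastSigner` alone would also accept misaligned fields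
such as `[h, hig, heg, n]`, whose rest `[h]` cannot be completed. -/
theorem SignedPath.length_eq {t k : ℕ} {itf : Itf} (h : SignedPath T facts t itf k) :
    itf.length = 3 * k := by
  induction h with
  | nil => rfl
  | cons itfv h rest k hl _ _ ih =>
    rcases hl with ⟨_, _, rfl, rfl⟩ | ⟨_, _, _, _, rfl, rfl⟩ <;> simp at ih ⊢ <;> omega

/-- The extension clause with an empty prefix also fits three entries, but it records the same
customer link. -/
theorem Issued.customer_of_core {t ceg m : ℕ} (h : Issued T n t [n, ceg, m]) :
    Derived T (.customer n m ceg) n t := by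
  rcases h with ⟨nei, ceg', e, h⟩ | ⟨p, ing, eg, nei, td, tl, ol, sl, sg, e, h, -⟩
  · cases e
    exact h
  · have hp : p = [] := List.length_eq_zero_iff.1 (by simpa using congrArg List.length e)
    subst hp
    cases e
    exact h

/-- An honest node that is not the first one on the path has links to its neighbours on the path it
issues, and has verified the preceding part of the path. -/
theorem Issued.links (hsig : SigAxiom T facts) (hn : Honest T facts n) {t : ℕ} {p : Itf}
    {ig eg m : ℕ} (h : Issued T n t (p ++ [n, ig, eg, m])) :
    ReceivedFrom T n t ig (p ++ [n]) ∧ Derived T (.customer n m eg) n t ∧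
      ∃ td tl ol sl sg, Derived T (.verifiedBeacon n td (p ++ [n, ig]) tl ol sl sg) n t ∧
        p.length + 1 = 3 * sl.length := by
  rcases h with ⟨nei, ceg', e, -⟩ | ⟨q, ing, eg', nei, td, tl, ol, sl, sg, e, hc, hv⟩
  · have := congrArg List.length e
    simp at this
  · have e' : (p ++ [n]) ++ [ig, eg, m] = q ++ [ing, eg', nei] := by simpa using e
    obtain ⟨rfl, h₂⟩ := List.append_inj' e' rfl
    cases h₂
    obtain ⟨itf', ing, e, ⟨hr, -⟩, hs⟩ := hv.signedPath hsig hn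
    obtain ⟨rfl, h₂⟩ := List.append_inj' e rfl
    cases h₂
    exact ⟨hr, hc, td, tl, ol, sl, sg, by simpa using hv, by simpa using hs.length_eq⟩

theorem ReceivedFrom.provider_of_core {t c ceg ig : ℕ} (h : ReceivedFrom T n t ig [c, ceg, n]) :
    Derived T (.provider n c ig) n t := by
  rcases h with ⟨_, _, e, h⟩ | ⟨p, _, _, _, e, -⟩
  · cases e
    exact h
  · have := congrArg List.length e
    simp at this

theorem ReceivedFrom.provider {t q hig heg ig : ℕ} {p : Itf}
    (h : ReceivedFrom T n t ig (p ++ [q, hig, heg, n])) : Derived T (.provider n q ig) n t := by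
  rcases h with ⟨_, _, e, -⟩ | ⟨p', _, _, _, e, h⟩
  · have := congrArg List.length e
    simp at this
  · obtain ⟨rfl, h₂⟩ := List.append_inj' e rfl
    cases h₂
    exact h

/-! ### From signed paths to good information -/

/-- A signed path that starts at a known core is good, whatever the signatures are. -/
theorem SignedPath.goodInfo (hsig : SigAxiom T facts) {t : ℕ} {td : TD} {ad core ctf : ℕ}
    (hcore : Derived T (.coreTD ad core td ctf) ad t) {itf : Itf} {k : ℕ}
    (h : SignedPath T facts t itf k) (hhead : itf.head? = some core) {sl : List Sig}
    (hsl : sl.length = k) : GoodInfo T facts t td ad sl itf := by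
  induction h generalizing sl with
  | nil => simp at hhead
  | cons itf q rest k hl hq hrest ih =>
    obtain ⟨s, sl, rfl⟩ := List.exists_cons_of_length_eq_add_one hsl
    replace hsl : sl.length = k := by simpa using hsl
    have hlen := hrest.length_eq
    rcases hl with ⟨ceg, n, rfl, rfl⟩ | ⟨p, ig, eg, m, rfl, rfl⟩
    · obtain rfl : sl = [] := List.length_eq_zero_iff.1 (by simp at hlen; omega)
      cases hhead
      refine .core _ _ _ ctf s hcore fun hc => ?_
      obtain ⟨t', ht', h⟩ := hq hc
      exact ⟨t', ht', h.customer_of_core⟩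
    · have hp : p ≠ [] := by
        rintro rfl
        simp at hlen
        omega
      have hgood := ih (by simpa [List.head?_append_of_ne_nil, hp] using hhead) hsl
      generalize hpq : p ++ [q] = r at hrest
      -- The previous issuer `h'` is the provider of `q`; whether it is the core decides between the
      -- clauses `first` and `later`.
      cases hrest with
      | nil => simp at hpq
      | cons _ h' rest k hl' hq' hrest =>
        subst hpq
        rcases hl' with ⟨ceg, n, e, rfl⟩ | ⟨p', hig, heg, n, e, rfl⟩
        · have e' : p ++ [q] = [h', ceg] ++ [n] := e
          obtain ⟨rfl, h₂⟩ := List.append_inj' e' rfl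
          cases h₂
          obtain ⟨s', rfl⟩ : ∃ s', sl = [s'] :=
            List.length_eq_one_iff.1 (by simp at hlen; omega)
          cases hhead
          refine .first _ ceg q ig eg m ctf s' s hcore (fun hc => ?_) hgood
          obtain ⟨t', ht', h⟩ := hq hc
          obtain ⟨hr, hcu, td', tl, ol, sl, sg, hv, hl⟩ := h.links hsig hc
          obtain ⟨s'', rfl⟩ : ∃ s', sl = [s'] :=
            List.length_eq_one_iff.1 (by simp at hl; omega)
          exact ⟨t', ht', hr.provider_of_core, hcu, td', tl, ol, sg, s'', hv⟩
        · have e' : p ++ [q] = (p' ++ [h', hig, heg]) ++ [n] := by simpa using e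
          obtain ⟨rfl, h₂⟩ := List.append_inj' e' rfl
          cases h₂
          rw [e] at hgood
          have := GoodInfo.later p' h' hig heg q ig eg m s sl (fun hc => ?_) hgood
          · simpa using this
          obtain ⟨t', ht', h⟩ := hq hc
          obtain ⟨hr, hcu, td', tl, ol, sl, sg, hv, hl⟩ := h.links hsig hc
          -- Without signatures the path verified by `q` would have length zero.
          obtain ⟨s'', sl'', rfl⟩ : ∃ s' sl', sl = s' :: sl' :=
            List.exists_cons_of_ne_nil (by rintro rfl; simp at hl)
          rw [e] at hr
          exact ⟨t', ht', hr.provider, hcu, td', tl, ol, sg, s'', sl'', by simpa using hv⟩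

/-! ### Beacons sent by an honest node -/

/-- The sender is itself the core on the path, so both requirements of the clause `core` are local
body tuples of `b5`. -/
theorem Derived.goodInfo_of_beaconIni (hn : Honest T facts n)
    {m t : ℕ} {td : TD} {itf : Itf} {tl : List Stamp} {ol : List HopField} {sl : List Sig}
    {sg : Sig} (h : Derived T (.beaconIni m n td itf tl ol sl sg) n t) :
    GoodInfo T facts t td n sl itf := by
  obtain ⟨x, hx, e, hb⟩ := h.exists_rule hn (by simp [Tuple.rel, Rel.IsBase])
  obtain ⟨_, ctf, _, _, _, _, _, _, rfl⟩ := hx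
  cases e
  exact .core _ _ _ ctf _ (hb _ (by simp) (by simp [Tuple.rel, Rel.IsReceived])) fun _ =>
    ⟨t, le_rfl, hb _ (by simp) (by simp [Tuple.rel, Rel.IsReceived])⟩

/-- The verified path is signed, and `n` is one further issuer, whose own body tuples in `b13`
witness `Issued` at time `t`. -/
theorem Derived.goodInfo_of_beaconFwd (hsig : SigAxiom T facts) (hn : Honest T facts n)
    {m t : ℕ} {td : TD} {itf : Itf} {tl : List Stamp} {ol : List HopField} {sl : List Sig}
    {sg : Sig} (h : Derived T (.beaconFwd m n td itf tl ol sl sg) n t) :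
    GoodInfo T facts t td n sl itf := by
  obtain ⟨x, hx, e, hb⟩ := h.exists_rule hn (by simp [Tuple.rel, Rel.IsBase])
  obtain ⟨_, p, ing, tl, ol, sl, sg, nei, eg, _, _, sig, rfl⟩ := hx
  cases e
  have hv := hb (.verifiedBeacon ..) (List.mem_cons_self ..) (by simp [Tuple.rel, Rel.IsReceived])
  have hc : Derived T (.customer n m eg) n t :=
    hb _ (by simp) (by simp [Tuple.rel, Rel.IsReceived])
  obtain ⟨itf', ing', e, ⟨hr, core, ctf, hhead, hcore⟩, hs⟩ := hv.signedPath hsig hn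
  obtain ⟨rfl, h₂⟩ := List.append_inj' e rfl
  cases h₂
  -- `LastSigner` needs `n` as the final entry of the received path; `b6` and `b7` accept only paths
  -- addressed to `n`.
  have hlast : ∃ p', p = p' ++ [n] := by
    rcases hr with ⟨c, ceg, rfl, -⟩ | ⟨p', q, hig, heg, rfl, -⟩
    · exact ⟨[c, ceg], rfl⟩
    · exact ⟨p' ++ [q, hig, heg], by simp⟩
  refine SignedPath.goodInfo hsig hcore (k := sl.length + 1)
    (.cons _ n p _ (.inr ?_) (fun _ => ⟨t, le_rfl, .inr ?_⟩) hs) ?_ rfl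
  · obtain ⟨p', rfl⟩ := hlast
    exact ⟨p', ing, eg, m, by simp, rfl⟩
  · exact ⟨p, ing, eg, m, _, _, _, _, _, by simp, hc, hv⟩
  · simp [hhead]

end SCION

theorem mainTheorem3 (F : SCION.Crypto) (facts : SCION.AD → List SCION.BaseFact)
    (T : SCION.Trace F) (hsig : SCION.SigAxiom T facts) :
    SCION.BeaconInvariant T facts ∧ SCION.RouteAuthenticity T facts := by
  refine ⟨fun n _ _ hn t m td itf tl ol sl sg _ _ => ⟨fun h => ?_, fun h => ?_⟩,
    fun n m t td itf tl ol sl sg hn h => ?_⟩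
  · exact h.goodInfo_of_beaconIni hn.of_bot
  · exact h.goodInfo_of_beaconFwd hsig hn.of_bot
  · exact h.elim (·.goodInfo_of_beaconIni hn) (·.goodInfo_of_beaconFwd hsig hn)
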